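/- Let $b>0$, and let $n$ bidders compete for $m$ items. The types $t_1,\dots,t_n\in[0,b]$ are independent, and $t_i$ has probability density $f_i$ on $[0,b]$ (the densities may differ across bidders). A feasible mechanism specifies measurable payments $pay_i(\mathbf t)$ and measurable allocation probabilities $q_i^j(\mathbf t)\ge 0$ (bidder $i$, item $j$) with $\sum_i q_i^j(\mathbf t)\le 1$ for every item $j$ and every type profile $\mathbf t\in[0,b]^n$. It implements the interim allocation rule consisting of measurable functions $q_i^j:[0,b]\to[0,1]$ if $q_i^j(t_i)=\mathbb E_{\mathbf t_{-i}}[q_i^j(t_i,\mathbf t_{-i})]$ for all $i$, $j$ and all $t_i\in[0,b]$. An interim allocation rule $(q_i^j)$ is implemented by some feasible mechanism if and only if, for all measurable virtual value functions $x_i^j:[0,b]\to[0,\infty)$ and every item $j$, $$\sum_{i=1}^n\int_0^b q_i^j(t)f_i(t)x_i^j(t)\,dt\;\le\;\int_0^{\infty}\Big[1-\prod_{i=1}^n\Big(1-\int_{\{t\in[0,b]:\,x_i^j(t)\ge v\}}f_i(t)\,dt\Big)\Big]dv ,$$ an inequality in $[0,\infty]$. This subsumes Border's theorem: for measurable sets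 $S_1,\dots,S_n\subseteq[0,b]$ and $x_i^j=\mathbf 1_{S_i}$ the inequality is equivalent to Border's inequality $$\sum_{i=1}^n\int_{S_i} q_i^j(t)f_i(t)\,dt\;\le\;1-\prod_{i=1}^n\Big(1-\int_{S_i}f_i(t)\,dt\Big),$$ and $(q_i^j)$ is implemented by some feasible mechanism if and only if Border's inequality holds for every item $j$ and all measurable $S_1,\dots,S_n\subseteq[0,b]$. -/

import Mathlib

namespace Auction

/-- `f` is a probability density on the type interval `[0, b]`.  (A nonzero Bochner integral is
only possible for an integrable `f`, so integrability is part of the last field.) -/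
structure IsTypeDensity (b : ℝ) (f : ℝ → ℝ) : Prop where
  measurable : Measurable f
  nonneg : ∀ t ∈ Set.Icc 0 b, 0 ≤ f t
  integral_eq_one : ∫ t in Set.Icc 0 b, f t = 1

/-- The law on `[0, b]` of a type with density `f`. -/
noncomputable def typeLaw (b : ℝ) (f : ℝ → ℝ) : MeasureTheory.Measure ℝ :=
  (MeasureTheory.volume.restrict (Set.Icc 0 b)).withDensity (fun t => ENNReal.ofReal (f t))

/-- A direct mechanism with `n` bidders and `m` items: at a profile `t` of reported types,
bidder `i` is allocated item `j` with probability `alloc j i t` and pays `pay i t`. -/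
structure DirectMechanism (m n : ℕ) where
  alloc : Fin m → Fin n → (Fin n → ℝ) → ℝ
  pay : Fin n → (Fin n → ℝ) → ℝ
  measurable_alloc : ∀ j i, Measurable (alloc j i)
  measurable_pay : ∀ i, Measurable (pay i)

variable {m n : ℕ}

/-- Ex post feasibility: at every type profile in `[0, b]^n`, allocation probabilities are
nonnegative and each item is allocated with total probability at most one. -/
def DirectMechanism.IsFeasible (M : DirectMechanism m n) (b : ℝ) : Prop :=
  ∀ t : Fin n → ℝ, (∀ i, t i ∈ Set.Icc 0 b) →
    ∀ j, (∀ i, 0 ≤ M.alloc j i t) ∧ ∑ i, M.alloc j i t ≤ 1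

/-- The interim allocation `E_{t_{-i}}[alloc j i (s, t_{-i})]` of item `j` to bidder `i` of type
`s`, the types being independent with densities `f k`.  The integrand does not depend on the
`i`-th coordinate of `t`, which is overwritten by `s`, so integrating over the law of the whole
profile is the same as integrating over `t_{-i}`. -/
noncomputable def DirectMechanism.interim (M : DirectMechanism m n) (b : ℝ)
    (f : Fin n → ℝ → ℝ) (j : Fin m) (i : Fin n) (s : ℝ) : ℝ :=
  ∫ t, M.alloc j i (Function.update t i s) ∂(MeasureTheory.Measure.pi fun k => typeLaw b (f k))

/-- An interim allocation rule: `q j i s` is the probability that bidder `i` gets item `j`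
when his type is `s ∈ [0, b]`. -/
structure IsInterimRule (b : ℝ) (q : Fin m → Fin n → ℝ → ℝ) : Prop where
  measurable : ∀ j i, Measurable (q j i)
  mem_Icc : ∀ j i, ∀ s ∈ Set.Icc 0 b, q j i s ∈ Set.Icc (0 : ℝ) 1

/-- `q` is the interim allocation rule of some feasible mechanism. -/
def Implementable (b : ℝ) (f : Fin n → ℝ → ℝ) (q : Fin m → Fin n → ℝ → ℝ) : Prop :=
  ∃ M : DirectMechanism m n, M.IsFeasible b ∧
    ∀ j i, ∀ s ∈ Set.Icc 0 b, q j i s = M.interim b f j i s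

/-- A virtual value function for one bidder: a measurable function `[0, b] → [0, ∞)`, possibly
unbounded. -/
structure IsVirtualValue (b : ℝ) (x : ℝ → ℝ) : Prop where
  measurable : Measurable x
  nonneg : ∀ t ∈ Set.Icc 0 b, 0 ≤ x t

/-- The virtual surplus inequality for one item,
`∑ i, ∫₀ᵇ qᵢ fᵢ xᵢ dt ≤ ∫₀^∞ (1 - ∏ i, (1 - ∫_{xᵢ(t) ≥ v} fᵢ(t) dt)) dv`.
Both sides are integrals of nonnegative functions, with values in `[0, ∞]`. -/
def SurplusInequality (b : ℝ) (f q x : Fin n → ℝ → ℝ) : Prop :=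
  ∑ i, ∫⁻ t in Set.Icc 0 b, ENNReal.ofReal (q i t * f i t * x i t) ≤
    ∫⁻ v in Set.Ioi (0 : ℝ),
      ENNReal.ofReal (1 - ∏ i, (1 - ∫ t in {t | t ∈ Set.Icc 0 b ∧ v ≤ x i t}, f i t))

/-- Border's inequality for one item and the sets of types `S i`. -/
def BorderInequality (f q : Fin n → ℝ → ℝ) (S : Fin n → Set ℝ) : Prop :=
  ∑ i, ∫ t in S i, q i t * f i t ≤ 1 - ∏ i, (1 - ∫ t in S i, f i t)

end Auction

/-!
Taking interim expectations is a continuous linear map `T` between `L²` spaces, and the feasible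
allocations of an item form a closed, convex and bounded set `Q`, so that `T(Q)` is closed and
convex. If an interim rule is not in `T(Q)`, it is separated from `T(Q)` by a linear functional,
namely the inner product with a profile `x` of virtual values. The largest value of this
functional on `T(Q)` is attained at the efficient allocation, which gives the item to a bidder
with the highest virtual value if that is nonnegative; it is the expected highest virtual value.
So the rule violates the surplus inequality for the positive part of `x`. A rule in `T(Q)` is
implemented up to a null set of types of each bidder, where the allocation can be corrected by
hand.

Border's inequalities suffice because, by the layer cake formula, the surplus inequality for `x`
is the integral over `v > 0` of Border's inequalities for the level sets `{x i ≥ v}`.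
-/

open MeasureTheory Filter Topology
open scoped ENNReal

namespace Auction

section Hilbert

variable {E F : Type*} [NormedAddCommGroup E] [InnerProductSpace ℝ E]
  [NormedAddCommGroup F] [InnerProductSpace ℝ F]

theorem exists_mem_forall_real_inner_sub_nonpos [CompleteSpace E] {S : Set E} (hne : S.Nonempty)
    (hclosed : IsClosed S) (hconvex : Convex ℝ S) (p : E) :
    ∃ v ∈ S, ∀ w ∈ S, inner ℝ (p - v) (w - v) ≤ 0 := by
  obtain ⟨v, hv, hmin⟩ :=
    exists_norm_eq_iInf_of_complete_convex hne hclosed.isComplete hconvex p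
  exact ⟨v, hv, (norm_eq_iInf_iff_real_inner_le_zero hconvex hv).1 hmin⟩

theorem exists_mem_forall_norm_sub_sq_le [CompleteSpace E] {S : Set E} (hne : S.Nonempty)
    (hclosed : IsClosed S) (hconvex : Convex ℝ S) :
    ∃ v ∈ S, ∀ w ∈ S, ‖w - v‖ ^ 2 ≤ ‖w‖ ^ 2 - ‖v‖ ^ 2 := by
  obtain ⟨v, hv, hvar⟩ := exists_mem_forall_real_inner_sub_nonpos hne hclosed hconvex 0
  refine ⟨v, hv, fun w hw => ?_⟩
  have hexpand : ‖w‖ ^ 2 = ‖w - v‖ ^ 2 + 2 * inner ℝ (w - v) v + ‖v‖ ^ 2 := by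
    rw [← norm_add_sq_real, sub_add_cancel]
  have hinner := hvar w hw
  rw [zero_sub, inner_neg_left, real_inner_comm] at hinner
  linarith

theorem nonempty_iInter_of_antitone_of_isClosed_of_convex [CompleteSpace E] {A : ℕ → Set E}
    (hA : Antitone A) (hne : ∀ k, (A k).Nonempty) (hclosed : ∀ k, IsClosed (A k))
    (hconvex : ∀ k, Convex ℝ (A k)) (hbdd : Bornology.IsBounded (A 0)) :
    (⋂ k, A k).Nonempty := by
  choose v hvA hv using fun k =>
    exists_mem_forall_norm_sub_sq_le (hne k) (hclosed k) (hconvex k)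
  have hgap : ∀ ⦃k l⦄, k ≤ l → ‖v l - v k‖ ^ 2 ≤ ‖v l‖ ^ 2 - ‖v k‖ ^ 2 :=
    fun k l hkl => hv k (v l) (hA hkl (hvA l))
  have hmono : Monotone fun k => ‖v k‖ ^ 2 := fun k l hkl =>
    sub_nonneg.1 ((sq_nonneg _).trans (hgap hkl))
  obtain ⟨R, hR⟩ := hbdd.exists_norm_le
  have hnorm : BddAbove (Set.range fun k => ‖v k‖ ^ 2) := by
    refine ⟨R ^ 2, ?_⟩
    rintro _ ⟨k, rfl⟩
    exact pow_le_pow_left₀ (norm_nonneg _) (hR _ (hA k.zero_le (hvA k))) 2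
  have hcauchy : CauchySeq v := by
    have hlim := (tendsto_atTop_ciSup hmono hnorm).cauchySeq
    rw [Metric.cauchySeq_iff'] at hlim ⊢
    intro ε hε
    obtain ⟨K, hK⟩ := hlim (ε ^ 2) (pow_pos hε 2)
    refine ⟨K, fun k hk => ?_⟩
    rw [dist_eq_norm]
    refine lt_of_pow_lt_pow_left₀ 2 hε.le ((hgap hk).trans_lt ?_)
    exact (le_abs_self _).trans_lt (hK k hk)
  obtain ⟨z, hz⟩ := cauchySeq_tendsto_of_complete hcauchy
  refine ⟨z, Set.mem_iInter.2 fun k => (hclosed k).mem_of_tendsto hz ?_⟩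
  filter_upwards [eventually_ge_atTop k] with l hl using hA hl (hvA l)

theorem isClosed_image_of_isClosed_of_convex_of_isBounded [CompleteSpace E] (T : E →L[ℝ] F)
    {Q : Set E} (hclosed : IsClosed Q) (hconvex : Convex ℝ Q) (hbdd : Bornology.IsBounded Q) :
    IsClosed (T '' Q) := by
  refine isClosed_of_closure_subset fun p hp => ?_
  let A : ℕ → Set E := fun k => Q ∩ T ⁻¹' Metric.closedBall p (1 / (k + 1))
  have hA : Antitone A := fun k l hkl => Set.inter_subset_inter_right _
    (Set.preimage_mono (Metric.closedBall_subset_closedBall (Nat.one_div_le_one_div hkl)))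
  have hne : ∀ k, (A k).Nonempty := fun k => by
    obtain ⟨_, ⟨y, hyQ, rfl⟩, hy⟩ := Metric.mem_closure_iff.1 hp _ (Nat.one_div_pos_of_nat (n := k))
    exact ⟨y, hyQ, by simpa [dist_comm] using hy.le⟩
  obtain ⟨y, hy⟩ := nonempty_iInter_of_antitone_of_isClosed_of_convex hA hne
    (fun k => hclosed.inter (Metric.isClosed_closedBall.preimage T.continuous))
    (fun k => hconvex.inter ((convex_closedBall p _).linear_preimage T.toLinearMap))
    (hbdd.subset Set.inter_subset_left)
  rw [Set.mem_iInter] at hy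
  have hdist : dist (T y) p ≤ 0 :=
    ge_of_tendsto' tendsto_one_div_add_atTop_nhds_zero_nat fun k => (hy k).2
  exact ⟨y, (hy 0).1, dist_le_zero.1 hdist⟩

theorem mem_of_forall_exists_real_inner_le [CompleteSpace F] {S : Set F} (hclosed : IsClosed S)
    (hconvex : Convex ℝ S) {p : F} (h : ∀ x : F, ∃ s ∈ S, inner ℝ x p ≤ inner ℝ x s) :
    p ∈ S := by
  obtain ⟨s, hs, -⟩ := h 0
  obtain ⟨v, hv, hvar⟩ := exists_mem_forall_real_inner_sub_nonpos ⟨s, hs⟩ hclosed hconvex p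
  obtain ⟨w, hw, hpw⟩ := h (p - v)
  have hself : inner ℝ (p - v) (p - v) ≤ 0 := by
    have hvw := hvar w hw
    rw [inner_sub_right] at hvw ⊢
    linarith
  rwa [sub_eq_zero.1 (real_inner_self_nonpos.1 hself)]

end Hilbert

section AEValuedIn

variable {Ω E : Type*} [MeasurableSpace Ω] [NormedAddCommGroup E] {C : Set E} {p : ℝ≥0∞}
  {P : Measure Ω}

/-- The classes in `Lp` of functions with values almost everywhere in `C`.  For `C` the set of
feasible divisions of an item, these are the ex post feasible allocations. -/
def aeValuedIn (C : Set E) (p : ℝ≥0∞) (P : Measure Ω) : Set (Lp E p P) :=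
  {y | ∀ᵐ t ∂P, y t ∈ C}

theorem isClosed_aeValuedIn [Fact (1 ≤ p)] (hC : IsClosed C) : IsClosed (aeValuedIn C p P) := by
  refine IsSeqClosed.isClosed fun u y hu hy => ?_
  obtain ⟨σ, -, hlim⟩ := (tendstoInMeasure_of_tendsto_Lp hy).exists_seq_tendsto_ae
  filter_upwards [hlim, ae_all_iff.2 fun k => hu (σ k)] with t ht hut
  exact hC.mem_of_tendsto ht (Eventually.of_forall hut)

theorem convex_aeValuedIn [NormedSpace ℝ E] (hC : Convex ℝ C) :
    Convex ℝ (aeValuedIn C p P) := by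
  intro y hy z hz a c ha hc hac
  filter_upwards [hy, hz, Lp.coeFn_add (a • y) (c • z), Lp.coeFn_smul a y, Lp.coeFn_smul c z]
    with t hyt hzt hadd hay hcz
  rw [hadd, Pi.add_apply, hay, hcz]
  exact hC hyt hzt ha hc hac

theorem isBounded_aeValuedIn [Fact (1 ≤ p)] [IsFiniteMeasure P] (hC : Bornology.IsBounded C) :
    Bornology.IsBounded (aeValuedIn C p P) := by
  obtain ⟨R, hRpos, hR⟩ := hC.exists_pos_norm_le
  refine isBounded_iff_forall_norm_le.2 ⟨_, fun y hy => Lp.norm_le_of_ae_bound hRpos.le ?_⟩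
  filter_upwards [hy] with t ht using hR _ ht

theorem exists_measurable_forall_mem_ae_eq [MeasurableSpace E] [BorelSpace E]
    (hC : MeasurableSet C) (hne : C.Nonempty) {y : Lp E p P} (hy : y ∈ aeValuedIn C p P) :
    ∃ a : Ω → E, Measurable a ∧ (∀ t, a t ∈ C) ∧ a =ᵐ[P] y := by
  classical
  obtain ⟨c, hc⟩ := hne
  have hmeas : Measurable y := (Lp.stronglyMeasurable y).measurable
  refine ⟨(y ⁻¹' C).piecewise y fun _ => c, hmeas.piecewise (hmeas hC) measurable_const,
    fun t => ?_, ?_⟩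
  · by_cases ht : y t ∈ C <;> simp [Set.piecewise, ht, hc]
  · filter_upwards [hy] with t ht
    exact Set.piecewise_eq_of_mem _ _ _ ht

end AEValuedIn

section FeasibleShares

variable {ι : Type*} [Fintype ι]

/-- The ways of dividing one unit of an item among the bidders `ι`, possibly withholding a part
of it.  The Euclidean norm makes allocations elements of a Hilbert space. -/
def feasibleShares (ι : Type*) [Fintype ι] : Set (EuclideanSpace ℝ ι) :=
  {c | (∀ i, 0 ≤ c i) ∧ ∑ i, c i ≤ 1}

theorem zero_mem_feasibleShares : (0 : EuclideanSpace ℝ ι) ∈ feasibleShares ι := by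
  simp [feasibleShares]

theorem le_one_of_mem_feasibleShares {c : EuclideanSpace ℝ ι} (hc : c ∈ feasibleShares ι)
    (i : ι) : c i ≤ 1 :=
  (Finset.single_le_sum (fun k _ => hc.1 k) (Finset.mem_univ i)).trans hc.2

theorem isClosed_feasibleShares : IsClosed (feasibleShares ι) := by
  refine IsClosed.and ?_ (isClosed_le (by fun_prop) continuous_const)
  simp only [Set.ofPred_forall]
  exact isClosed_iInter fun i => isClosed_le continuous_const (by fun_prop)

theorem convex_feasibleShares : Convex ℝ (feasibleShares ι) := by
  intro c hc d hd α β hα hβ hαβ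
  refine ⟨fun i => ?_, ?_⟩
  · have := hc.1 i
    have := hd.1 i
    simp only [PiLp.add_apply, PiLp.smul_apply, smul_eq_mul]
    positivity
  · simp only [PiLp.add_apply, PiLp.smul_apply, smul_eq_mul, Finset.sum_add_distrib,
      ← Finset.mul_sum]
    nlinarith [hc.2, hd.2]

theorem isBounded_feasibleShares : Bornology.IsBounded (feasibleShares ι) := by
  refine isBounded_iff_forall_norm_le.2 ⟨1, fun c hc => ?_⟩
  rw [← sq_le_one_iff₀ (norm_nonneg c), EuclideanSpace.real_norm_sq_eq]
  calc ∑ i, c i ^ 2 ≤ ∑ i, c i := Finset.sum_le_sum fun i _ =>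
        pow_le_of_le_one (hc.1 i) (le_one_of_mem_feasibleShares hc i) two_ne_zero
    _ ≤ 1 := hc.2

end FeasibleShares

section Interim

variable {ι : Type*} [Fintype ι] [DecidableEq ι] {X : ι → Type*} [∀ i, MeasurableSpace (X i)]

theorem measurePreserving_update (μ : ∀ i, Measure (X i)) [∀ i, IsProbabilityMeasure (μ i)]
    (i : ι) :
    MeasurePreserving (fun p : X i × (∀ k, X k) => Function.update p.2 i p.1)
      ((μ i).prod (Measure.pi μ)) (Measure.pi μ) := by
  have hmeas : Measurable fun p : X i × (∀ k, X k) => Function.update p.2 i p.1 :=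
    measurable_update'.comp measurable_swap
  refine ⟨hmeas, (Measure.pi_eq fun s hs => ?_).symm⟩
  have hpre : (fun p : X i × (∀ k, X k) => Function.update p.2 i p.1) ⁻¹' Set.univ.pi s =
      s i ×ˢ Set.univ.pi (Function.update s i Set.univ) := by
    ext p
    simp only [Set.mem_preimage, Set.mem_pi, Set.mem_univ, true_imp_iff, Set.mem_prod]
    refine ⟨fun h => ⟨by simpa using h i, fun k => ?_⟩, fun h k => ?_⟩ <;>
      rcases eq_or_ne k i with rfl | hki
    · simp
    · simpa [hki] using h k
    · simpa using h.1
    · simpa [hki] using h.2 k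
  rw [Measure.map_apply hmeas (MeasurableSet.univ_pi hs), hpre, Measure.prod_prod,
    Measure.pi_pi, ← Finset.mul_prod_erase Finset.univ _ (Finset.mem_univ i),
    ← Finset.mul_prod_erase Finset.univ (fun k => μ k (s k)) (Finset.mem_univ i),
    Function.update_self, measure_univ, one_mul]
  congr 1
  exact Finset.prod_congr rfl fun k hk => by rw [Function.update_of_ne (Finset.ne_of_mem_erase hk)]

/-- The expectation of `a` conditional on bidder `i` having type `s`.  It is an integral over the
law of the whole profile, in which the `i`-th coordinate is overwritten by `s`. -/
noncomputable def interim (μ : ∀ i, Measure (X i)) (a : (∀ i, X i) → ℝ) (i : ι) (s : X i) : ℝ :=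
  ∫ t, a (Function.update t i s) ∂Measure.pi μ

variable {μ : ∀ i, Measure (X i)} [∀ i, IsProbabilityMeasure (μ i)] {a a' : (∀ i, X i) → ℝ}

theorem integrable_comp_update (ha : Integrable a (Measure.pi μ)) (i : ι) :
    Integrable (fun p : X i × (∀ k, X k) => a (Function.update p.2 i p.1))
      ((μ i).prod (Measure.pi μ)) :=
  (measurePreserving_update μ i).integrable_comp_of_integrable ha

theorem integrable_interim (ha : Integrable a (Measure.pi μ)) (i : ι) :
    Integrable (interim μ a i) (μ i) :=
  (integrable_comp_update ha i).integral_prod_left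

theorem integral_interim (ha : Integrable a (Measure.pi μ)) (i : ι) :
    ∫ s, interim μ a i s ∂μ i = ∫ t, a t ∂Measure.pi μ := by
  have hpres := measurePreserving_update μ i
  rw [← hpres.map_eq, integral_map hpres.aemeasurable (by rw [hpres.map_eq]; exact ha.1),
    integral_prod _ (integrable_comp_update ha i)]
  rfl

theorem setIntegral_interim (ha : Integrable a (Measure.pi μ)) (i : ι) {A : Set (X i)}
    (hA : MeasurableSet A) :
    ∫ s in A, interim μ a i s ∂μ i = ∫ t in Function.eval i ⁻¹' A, a t ∂Measure.pi μ := by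
  have hpre : MeasurableSet (Function.eval i ⁻¹' A : Set (∀ k, X k)) := measurable_pi_apply i hA
  rw [← integral_indicator hA, ← integral_indicator hpre,
    ← integral_interim (ha.indicator hpre) i]
  refine integral_congr_ae (Eventually.of_forall fun s => ?_)
  by_cases hs : s ∈ A <;> simp [interim, Set.indicator, hs]

theorem interim_congr_ae (h : a =ᵐ[Measure.pi μ] a') (i : ι) :
    interim μ a i =ᵐ[μ i] interim μ a' i := by
  filter_upwards [Measure.ae_ae_of_ae_prod
    ((measurePreserving_update μ i).quasiMeasurePreserving.ae h)] with s hs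
  exact integral_congr_ae hs

theorem lintegral_ofReal_interim_mul (ha : Integrable a (Measure.pi μ))
    (hnn : 0 ≤ᵐ[Measure.pi μ] a) (i : ι) {g : X i → ℝ≥0∞} (hg : Measurable g) :
    ∫⁻ s, ENNReal.ofReal (interim μ a i s) * g s ∂μ i =
      ∫⁻ t, ENNReal.ofReal (a t) * g (t i) ∂Measure.pi μ := by
  have hpres := measurePreserving_update μ i
  have hint := integrable_comp_update ha i
  have hmeas : AEMeasurable (fun t => ENNReal.ofReal (a t) * g (t i))
      (((μ i).prod (Measure.pi μ)).map fun p => Function.update p.2 i p.1) := by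
    rw [hpres.map_eq]
    exact ha.1.aemeasurable.ennreal_ofReal.mul (hg.comp (measurable_pi_apply i)).aemeasurable
  conv_rhs => rw [← hpres.map_eq, lintegral_map' hmeas hpres.aemeasurable]
  rw [lintegral_prod (fun p => ENNReal.ofReal (a (Function.update p.2 i p.1)) *
    g (Function.update p.2 i p.1 i)) (hmeas.comp_aemeasurable hpres.aemeasurable)]
  refine lintegral_congr_ae ?_
  filter_upwards [hint.prod_right_ae, Measure.ae_ae_of_ae_prod
    (hpres.quasiMeasurePreserving.ae hnn)] with s hs hs_nonneg
  simp only [Function.update_self]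
  rw [interim, ofReal_integral_eq_lintegral_ofReal hs hs_nonneg,
    lintegral_mul_const'' _ hs.1.aemeasurable.ennreal_ofReal]

end Interim

section InterimOperator

variable {ι : Type*} [Fintype ι] {X : ι → Type*} [∀ i, MeasurableSpace (X i)]
  (μ : ∀ i, Measure (X i)) [∀ i, IsProbabilityMeasure (μ i)]

/-- Taking interim expectations, as an operator on square integrable functions of the profile:
the adjoint of viewing a function of the type of bidder `i` as a function of the profile. -/
noncomputable def interimCLM (i : ι) : Lp ℝ 2 (Measure.pi μ) →L[ℝ] Lp ℝ 2 (μ i) :=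
  ContinuousLinearMap.adjoint
    (Lp.compMeasurePreservingₗᵢ ℝ (Function.eval i)
      (measurePreserving_eval μ i)).toContinuousLinearMap

theorem inner_interimCLM (i : ι) (x : Lp ℝ 2 (μ i)) (y : Lp ℝ 2 (Measure.pi μ)) :
    inner ℝ x (interimCLM μ i y) = ∫ t, x (t i) * y t ∂Measure.pi μ := by
  rw [interimCLM, ContinuousLinearMap.adjoint_inner_right, L2.inner_def]
  refine integral_congr_ae ?_
  filter_upwards [Lp.coeFn_compMeasurePreserving x (measurePreserving_eval μ i)] with t ht
  change inner ℝ (Lp.compMeasurePreserving _ (measurePreserving_eval μ i) x t) (y t) = _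
  rw [ht, Real.inner_apply]
  rfl

theorem setIntegral_interimCLM (i : ι) (y : Lp ℝ 2 (Measure.pi μ)) {A : Set (X i)}
    (hA : MeasurableSet A) :
    ∫ s in A, interimCLM μ i y s ∂μ i =
      ∫ t in Function.eval i ⁻¹' A, y t ∂Measure.pi μ := by
  rw [← L2.inner_indicatorConstLp_one hA (measure_ne_top _ _), inner_interimCLM,
    ← integral_indicator (measurable_pi_apply i hA)]
  refine integral_congr_ae ?_
  filter_upwards [(measurePreserving_eval μ i).quasiMeasurePreserving.ae
    (indicatorConstLp_coeFn (p := 2) (hs := hA) (hμs := measure_ne_top (μ i) A)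
      (c := (1 : ℝ)))] with t ht
  rw [Function.eval] at ht
  rw [ht]
  by_cases hs : t i ∈ A <;> simp [Set.indicator, hs]

theorem coeFn_interimCLM [DecidableEq ι] (i : ι) (y : Lp ℝ 2 (Measure.pi μ)) :
    interimCLM μ i y =ᵐ[μ i] interim μ y i := by
  have hy : Integrable y (Measure.pi μ) := (Lp.memLp y).integrable one_le_two
  have hTy : Integrable (interimCLM μ i y) (μ i) := (Lp.memLp _).integrable one_le_two
  refine hTy.ae_eq_of_forall_setIntegral_eq _ _ (integrable_interim hy i) fun A hA _ => ?_
  rw [setIntegral_interimCLM μ i y hA, setIntegral_interim hy i hA]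

/-- The operator that maps an allocation of an item to the profile of its interim allocation
rules. -/
noncomputable def profileInterimCLM :
    Lp (EuclideanSpace ℝ ι) 2 (Measure.pi μ) →L[ℝ] PiLp 2 fun i => Lp ℝ 2 (μ i) :=
  (PiLp.continuousLinearEquiv 2 ℝ fun i => Lp ℝ 2 (μ i)).symm.toContinuousLinearMap ∘L
    ContinuousLinearMap.pi fun i =>
      interimCLM μ i ∘L (EuclideanSpace.proj i).compLpL 2 (Measure.pi μ)

theorem profileInterimCLM_apply (y : Lp (EuclideanSpace ℝ ι) 2 (Measure.pi μ)) (i : ι) :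
    profileInterimCLM μ y i = interimCLM μ i ((EuclideanSpace.proj (𝕜 := ℝ) i).compLp y) :=
  rfl

theorem coeFn_profileInterimCLM [DecidableEq ι]
    (y : Lp (EuclideanSpace ℝ ι) 2 (Measure.pi μ)) (i : ι) :
    profileInterimCLM μ y i =ᵐ[μ i] interim μ (fun t => y t i) i := by
  rw [profileInterimCLM_apply]
  exact (coeFn_interimCLM μ i _).trans
    (interim_congr_ae (ContinuousLinearMap.coeFn_compLp _ y) i)

theorem inner_profileInterimCLM (x : PiLp 2 fun i => Lp ℝ 2 (μ i))
    (y : Lp (EuclideanSpace ℝ ι) 2 (Measure.pi μ)) :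
    inner ℝ x (profileInterimCLM μ y) = ∫ t, ∑ i, x i (t i) * y t i ∂Measure.pi μ := by
  have hint : ∀ i, Integrable (fun t => x i (t i) * y t i) (Measure.pi μ) := fun i =>
    ((Lp.memLp (x i)).comp_measurePreserving (measurePreserving_eval μ i)).integrable_mul
      ((Lp.memLp y).eval_piLp i)
  rw [PiLp.inner_apply, integral_finsetSum _ fun i _ => hint i]
  refine Finset.sum_congr rfl fun i _ => ?_
  rw [profileInterimCLM_apply, inner_interimCLM]
  refine integral_congr_ae ?_
  filter_upwards [ContinuousLinearMap.coeFn_compLp (EuclideanSpace.proj (𝕜 := ℝ) i) y] with t ht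
  rw [ht, PiLp.proj_apply]

end InterimOperator

section EfficientShares

variable {ι : Type*}

/-- The profiles of virtual values at which bidder `i` has the highest one and it is nonnegative. -/
def topSet (i : ι) : Set (ι → ℝ) := {x | 0 ≤ x i ∧ ∀ k, x k ≤ x i}

theorem measurableSet_topSet [Countable ι] (i : ι) : MeasurableSet (topSet i) := by
  have hmax : MeasurableSet {x : ι → ℝ | ∀ k, x k ≤ x i} := by
    simp only [Set.ofPred_forall]
    exact .iInter fun k => measurableSet_le (measurable_pi_apply k) (measurable_pi_apply i)
  exact (measurableSet_le measurable_const (measurable_pi_apply i)).inter hmax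

theorem exists_mem_topSet_or_forall_neg [Finite ι] (x : ι → ℝ) :
    (∃ i, x ∈ topSet i) ∨ ∀ i, x i < 0 := by
  cases isEmpty_or_nonempty ι
  · exact .inr isEmptyElim
  · obtain ⟨i, hi⟩ := Finite.exists_max x
    rcases le_or_gt 0 (x i) with h | h
    · exact .inl ⟨i, h, hi⟩
    · exact .inr fun k => (hi k).trans_lt h

variable [Fintype ι]

/-- The efficient division of an item at virtual values `x`: it goes to a bidder with the highest
virtual value, ties being split equally, and is withheld if all virtual values are negative (the
divisions below are then `0 / 0 = 0`). -/
noncomputable def efficientShares (x : ι → ℝ) : EuclideanSpace ℝ ι :=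
  WithLp.toLp 2 fun i => (topSet i).indicator 1 x / ∑ k, (topSet k).indicator 1 x

theorem efficientShares_apply (x : ι → ℝ) (i : ι) :
    efficientShares x i = (topSet i).indicator 1 x / ∑ k, (topSet k).indicator 1 x :=
  rfl

theorem measurable_efficientShares : Measurable (efficientShares (ι := ι)) := by
  have hind : ∀ i, Measurable ((topSet i).indicator (1 : (ι → ℝ) → ℝ)) := fun i =>
    measurable_one.indicator (measurableSet_topSet i)
  exact (WithLp.measurable_toLp 2 _).comp
    (measurable_pi_lambda _ fun i => (hind i).div (Finset.measurable_fun_sum _ fun k _ => hind k))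

theorem efficientShares_mem_feasibleShares (x : ι → ℝ) : efficientShares x ∈ feasibleShares ι := by
  have hind : ∀ i, 0 ≤ (topSet i).indicator (1 : (ι → ℝ) → ℝ) x := fun i =>
    Set.indicator_nonneg (fun _ _ => zero_le_one) x
  refine ⟨fun i => div_nonneg (hind i) (Finset.sum_nonneg fun k _ => hind k), ?_⟩
  simp only [efficientShares_apply, ← Finset.sum_div]
  exact div_self_le_one _

theorem sum_mul_efficientShares_of_mem_topSet {x : ι → ℝ} {i : ι} (hx : x ∈ topSet i) :
    ∑ k, x k * efficientShares x k = x i := by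
  have hone : (topSet i).indicator (1 : (ι → ℝ) → ℝ) x = 1 := Set.indicator_of_mem hx 1
  have hpos : 0 < ∑ k, (topSet k).indicator (1 : (ι → ℝ) → ℝ) x :=
    Finset.sum_pos' (fun k _ => Set.indicator_nonneg (fun _ _ => zero_le_one) x)
      ⟨i, Finset.mem_univ i, hone ▸ zero_lt_one⟩
  have hmax : ∀ k, x k * efficientShares x k = x i * efficientShares x k := fun k => by
    by_cases hk : x ∈ topSet k
    · rw [le_antisymm (hx.2 k) (hk.2 i)]
    · simp [efficientShares_apply, hk]
  have hsum : ∑ k, efficientShares x k = 1 := by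
    simp only [efficientShares_apply, ← Finset.sum_div, div_self hpos.ne']
  rw [Finset.sum_congr rfl fun k _ => hmax k, ← Finset.mul_sum, hsum, mul_one]

theorem efficientShares_of_forall_neg {x : ι → ℝ} (hx : ∀ i, x i < 0) : efficientShares x = 0 := by
  ext i
  have hi : x ∉ topSet i := fun h => (hx i).not_ge h.1
  simp [efficientShares_apply, hi]

theorem sum_mul_efficientShares_nonneg (x : ι → ℝ) : 0 ≤ ∑ i, x i * efficientShares x i := by
  rcases exists_mem_topSet_or_forall_neg x with ⟨i, hi⟩ | hneg
  · exact (sum_mul_efficientShares_of_mem_topSet hi).symm ▸ hi.1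
  · simp [efficientShares_of_forall_neg hneg]

theorem ofReal_sum_mul_efficientShares (x : ι → ℝ) :
    ENNReal.ofReal (∑ i, x i * efficientShares x i) = ⨆ i, ENNReal.ofReal (x i) := by
  rcases exists_mem_topSet_or_forall_neg x with ⟨i, hi⟩ | hneg
  · rw [sum_mul_efficientShares_of_mem_topSet hi]
    exact le_antisymm (le_iSup (fun k => ENNReal.ofReal (x k)) i)
      (iSup_le fun k => ENNReal.ofReal_le_ofReal (hi.2 k))
  · simp [efficientShares_of_forall_neg hneg, ENNReal.ofReal_of_nonpos (hneg _).le]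

end EfficientShares

section Surplus

variable {ι : Type*} [Fintype ι] {X : ι → Type*} [∀ i, MeasurableSpace (X i)]
  (μ : ∀ i, Measure (X i))

/-- The virtual surplus inequality for one item: with virtual values `x`, the interim rule `q`
yields at most the expectation of the highest virtual value (or `0`, if that is negative). -/
def SurplusBound (q x : ∀ i, X i → ℝ) : Prop :=
  ∑ i, ∫⁻ s, ENNReal.ofReal (q i s) * ENNReal.ofReal (x i s) ∂μ i ≤
    ∫⁻ t, ⨆ i, ENNReal.ofReal (x i (t i)) ∂Measure.pi μ

/-- Border's inequality for one item: with the interim rule `q`, bidders with types in the sets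
`S i` receive it with at most the probability that there is such a bidder. -/
def BorderBound (q : ∀ i, X i → ℝ) (S : ∀ i, Set (X i)) : Prop :=
  ∑ i, ∫⁻ s in S i, ENNReal.ofReal (q i s) ∂μ i ≤ Measure.pi μ {t | ∃ i, t i ∈ S i}

end Surplus

section LayerCake

variable {Ω : Type*} [MeasurableSpace Ω] {P : Measure Ω}

theorem ofReal_integral_le_lintegral_ofReal {g : Ω → ℝ} (hg : Integrable g P) :
    ENNReal.ofReal (∫ t, g t ∂P) ≤ ∫⁻ t, ENNReal.ofReal (g t) ∂P := by
  calc ENNReal.ofReal (∫ t, g t ∂P) ≤ ENNReal.ofReal (∫ t, max (g t) 0 ∂P) :=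
        ENNReal.ofReal_le_ofReal (integral_mono hg hg.pos_part fun t => le_max_left _ _)
    _ = ∫⁻ t, ENNReal.ofReal (g t) ∂P := by
        rw [ofReal_integral_eq_lintegral_ofReal hg.pos_part (.of_forall fun t => le_max_right _ _)]
        simp only [ENNReal.ofReal_max, ENNReal.ofReal_zero, max_zero]

theorem lintegral_ofReal_eq_lintegral_meas_le {g : Ω → ℝ} (hg : Measurable g) :
    ∫⁻ t, ENNReal.ofReal (g t) ∂P = ∫⁻ v in Set.Ioi 0, P {t | v ≤ g t} := by
  have hpos : ∫⁻ t, ENNReal.ofReal (max (g t) 0) ∂P =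
      ∫⁻ v in Set.Ioi 0, P {t | v ≤ max (g t) 0} :=
    lintegral_eq_lintegral_meas_le P (.of_forall fun t => le_max_right _ _)
      (hg.max measurable_const).aemeasurable
  simp only [ENNReal.ofReal_max, ENNReal.ofReal_zero, max_zero] at hpos
  rw [hpos]
  refine setLIntegral_congr_fun measurableSet_Ioi fun v (hv : 0 < v) => ?_
  simp only [le_max_iff, hv.not_ge, or_false]

theorem lintegral_iSup_ofReal_eq_lintegral_meas_exists_le {ι : Type*} [Finite ι] {z : ι → Ω → ℝ}
    (hz : ∀ i, Measurable (z i)) :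
    ∫⁻ t, ⨆ i, ENNReal.ofReal (z i t) ∂P = ∫⁻ v in Set.Ioi 0, P {t | ∃ i, v ≤ z i t} := by
  cases isEmpty_or_nonempty ι
  · simp
  have hofReal : ∀ t, ⨆ i, ENNReal.ofReal (z i t) = ENNReal.ofReal (⨆ i, z i t) := fun t =>
    (ENNReal.ofReal_mono.map_ciSup_of_continuousAt
      ENNReal.continuous_ofReal.continuousAt (Set.finite_range _).bddAbove).symm
  have hle : ∀ v t, v ≤ ⨆ i, z i t ↔ ∃ i, v ≤ z i t := fun v t => by
    obtain ⟨i, hi⟩ := exists_eq_ciSup_of_finite (f := fun i => z i t)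
    exact ⟨fun h => ⟨i, hi ▸ h⟩, fun ⟨k, hk⟩ =>
      hk.trans (le_ciSup (f := fun i => z i t) (Set.finite_range _).bddAbove k)⟩
  simp only [hofReal, lintegral_ofReal_eq_lintegral_meas_le (Measurable.iSup hz), hle]

end LayerCake

section Inequalities

variable {ι : Type*} [Fintype ι] {X : ι → Type*} [∀ i, MeasurableSpace (X i)]
  {μ : ∀ i, Measure (X i)} {q : ∀ i, X i → ℝ}

omit [Fintype ι] in
theorem measurableSet_exists_mem [Countable ι] {S : ∀ i, Set (X i)}
    (hS : ∀ i, MeasurableSet (S i)) : MeasurableSet {t : ∀ i, X i | ∃ i, t i ∈ S i} := by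
  simp only [Set.ofPred_exists]
  exact .iUnion fun i => measurable_pi_apply i (hS i)

theorem surplusBound_max_zero_iff {x : ∀ i, X i → ℝ} :
    SurplusBound μ q (fun i s => max (x i s) 0) ↔ SurplusBound μ q x := by
  simp only [SurplusBound, ENNReal.ofReal_max, ENNReal.ofReal_zero, max_zero]

theorem surplusBound_indicator_iff {S : ∀ i, Set (X i)} (hS : ∀ i, MeasurableSet (S i)) :
    SurplusBound μ q (fun i => (S i).indicator fun _ => 1) ↔ BorderBound μ q S := by
  have hofReal : ∀ i s, ENNReal.ofReal ((S i).indicator (fun _ => 1) s) =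
      (S i).indicator 1 s := fun i s => by
    by_cases hs : s ∈ S i <;> simp [hs]
  have hleft : ∀ i, ∫⁻ s, ENNReal.ofReal (q i s) * (S i).indicator 1 s ∂μ i =
      ∫⁻ s in S i, ENNReal.ofReal (q i s) ∂μ i := fun i => by
    rw [← lintegral_indicator (hS i)]
    congr with s
    by_cases hs : s ∈ S i <;> simp [hs]
  have hsup : ∀ t : ∀ i, X i, ⨆ i, (S i).indicator (1 : X i → ℝ≥0∞) (t i) =
      {t | ∃ i, t i ∈ S i}.indicator 1 t := fun t => by
    by_cases ht : ∃ i, t i ∈ S i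
    · obtain ⟨i, hi⟩ := ht
      rw [Set.indicator_of_mem (show t ∈ {t | ∃ i, t i ∈ S i} from ⟨i, hi⟩)]
      refine le_antisymm (iSup_le fun k => Set.indicator_le_self _ _ _) (le_iSup_of_le i ?_)
      rw [Set.indicator_of_mem hi, Pi.one_apply, Pi.one_apply]
    · have hti : ∀ i, t i ∉ S i := not_exists.1 ht
      simp [hti]
  simp only [SurplusBound, BorderBound, hofReal, hleft, hsup,
    lintegral_indicator_one (measurableSet_exists_mem hS)]

theorem surplusBound_of_forall_borderBound (hq : ∀ i, Measurable (q i))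
    (hborder : ∀ S : ∀ i, Set (X i), (∀ i, MeasurableSet (S i)) → BorderBound μ q S)
    {x : ∀ i, X i → ℝ} (hx : ∀ i, Measurable (x i)) : SurplusBound μ q x := by
  let ν : ∀ i, Measure (X i) := fun i => (μ i).withDensity fun s => ENNReal.ofReal (q i s)
  have hlevel : ∀ i v, MeasurableSet {s | v ≤ x i s} := fun i v =>
    measurableSet_le measurable_const (hx i)
  have hanti : ∀ i, Antitone fun v => ν i {s | v ≤ x i s} := fun i v w hvw =>
    measure_mono fun s hs => hvw.trans hs
  calc ∑ i, ∫⁻ s, ENNReal.ofReal (q i s) * ENNReal.ofReal (x i s) ∂μ i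
      = ∑ i, ∫⁻ s, ENNReal.ofReal (x i s) ∂ν i := Finset.sum_congr rfl fun i _ =>
        (lintegral_withDensity_eq_lintegral_mul _ (hq i).ennreal_ofReal
          (hx i).ennreal_ofReal).symm
    _ = ∫⁻ v in Set.Ioi 0, ∑ i, ν i {s | v ≤ x i s} := by
        rw [lintegral_finsetSum _ fun i _ => (hanti i).measurable]
        exact Finset.sum_congr rfl fun i _ => lintegral_ofReal_eq_lintegral_meas_le (hx i)
    _ ≤ ∫⁻ v in Set.Ioi 0, Measure.pi μ {t | ∃ i, v ≤ x i (t i)} := by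
        refine lintegral_mono fun v => ?_
        simp only [ν, withDensity_apply _ (hlevel _ v)]
        exact hborder (fun i => {s | v ≤ x i s}) fun i => hlevel i v
    _ = ∫⁻ t, ⨆ i, ENNReal.ofReal (x i (t i)) ∂Measure.pi μ :=
        (lintegral_iSup_ofReal_eq_lintegral_meas_exists_le fun i =>
          (hx i).comp (measurable_pi_apply i)).symm

end Inequalities

section Implementation

variable {ι : Type*} [Fintype ι] {X : ι → Type*} [∀ i, MeasurableSpace (X i)]
  {μ : ∀ i, Measure (X i)} {D : ∀ i, Set (X i)}

/-- An ex post feasible allocation of one item: at the type profile `t`, bidder `i` obtains it with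
probability `a i t`.  Feasibility is only required for types in `D i`. -/
structure IsAllocation (D : ∀ i, Set (X i)) (a : ι → (∀ i, X i) → ℝ) : Prop where
  measurable : ∀ i, Measurable (a i)
  nonneg : ∀ t, (∀ i, t i ∈ D i) → ∀ i, 0 ≤ a i t
  sum_le_one : ∀ t, (∀ i, t i ∈ D i) → ∑ i, a i t ≤ 1

/-- The interim rule `q` for one item comes from an ex post feasible allocation. -/
def InterimImplementable [DecidableEq ι] (μ : ∀ i, Measure (X i)) (D : ∀ i, Set (X i))
    (q : ∀ i, X i → ℝ) : Prop :=
  ∃ a, IsAllocation D a ∧ ∀ i, ∀ s ∈ D i, q i s = interim μ (a i) i s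

theorem ae_pi_forall_mem [∀ i, SigmaFinite (μ i)] (hD : ∀ i, ∀ᵐ s ∂μ i, s ∈ D i) :
    ∀ᵐ t ∂Measure.pi μ, ∀ i, t i ∈ D i :=
  ae_all_iff.2 fun i => Measure.tendsto_eval_ae_ae.eventually (hD i)

variable {q : ∀ i, X i → ℝ}

namespace IsAllocation

variable {a : ι → (∀ i, X i) → ℝ}

theorem sum_ofReal_mul_le_iSup (ha : IsAllocation D a) {t : ∀ i, X i} (ht : ∀ i, t i ∈ D i)
    (z : ι → ℝ≥0∞) : ∑ i, ENNReal.ofReal (a i t) * z i ≤ ⨆ i, z i :=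
  calc ∑ i, ENNReal.ofReal (a i t) * z i
      ≤ ∑ i, ENNReal.ofReal (a i t) * ⨆ k, z k := by gcongr with i; exact le_iSup z i
    _ = ENNReal.ofReal (∑ i, a i t) * ⨆ k, z k := by
        rw [← Finset.sum_mul, ENNReal.ofReal_sum_of_nonneg fun i _ => ha.nonneg t ht i]
    _ ≤ ⨆ k, z k :=
        mul_le_of_le_one_left zero_le (ENNReal.ofReal_le_one.2 (ha.sum_le_one t ht))

theorem integrable [∀ i, IsProbabilityMeasure (μ i)] (ha : IsAllocation D a)
    (hD : ∀ i, ∀ᵐ s ∂μ i, s ∈ D i) (i : ι) : Integrable (a i) (Measure.pi μ) := by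
  refine Integrable.of_bound (ha.measurable i).aestronglyMeasurable 1 ?_
  filter_upwards [ae_pi_forall_mem hD] with t ht
  rw [Real.norm_of_nonneg (ha.nonneg t ht i)]
  exact (Finset.single_le_sum (fun k _ => ha.nonneg t ht k) (Finset.mem_univ i)).trans
    (ha.sum_le_one t ht)

end IsAllocation

variable [DecidableEq ι] [∀ i, IsProbabilityMeasure (μ i)]

theorem InterimImplementable.surplusBound (h : InterimImplementable μ D q)
    (hD : ∀ i, ∀ᵐ s ∂μ i, s ∈ D i) {x : ∀ i, X i → ℝ} (hx : ∀ i, Measurable (x i)) :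
    SurplusBound μ q x := by
  obtain ⟨a, ha, hq⟩ := h
  have hnn : ∀ i, 0 ≤ᵐ[Measure.pi μ] a i := fun i => by
    filter_upwards [ae_pi_forall_mem hD] with t ht using ha.nonneg t ht i
  have hmeas : ∀ i, Measurable fun t => ENNReal.ofReal (a i t) * ENNReal.ofReal (x i (t i)) :=
    fun i => (ha.measurable i).ennreal_ofReal.mul
      ((hx i).comp (measurable_pi_apply i)).ennreal_ofReal
  calc ∑ i, ∫⁻ s, ENNReal.ofReal (q i s) * ENNReal.ofReal (x i s) ∂μ i
      = ∑ i, ∫⁻ s, ENNReal.ofReal (interim μ (a i) i s) * ENNReal.ofReal (x i s) ∂μ i := by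
        refine Finset.sum_congr rfl fun i _ => lintegral_congr_ae ?_
        filter_upwards [hD i] with s hs
        rw [hq i s hs]
    _ = ∑ i, ∫⁻ t, ENNReal.ofReal (a i t) * ENNReal.ofReal (x i (t i)) ∂Measure.pi μ :=
        Finset.sum_congr rfl fun i _ =>
          lintegral_ofReal_interim_mul (ha.integrable hD i) (hnn i) i (hx i).ennreal_ofReal
    _ = ∫⁻ t, ∑ i, ENNReal.ofReal (a i t) * ENNReal.ofReal (x i (t i)) ∂Measure.pi μ :=
        (lintegral_finsetSum _ fun i _ => hmeas i).symm
    _ ≤ ∫⁻ t, ⨆ i, ENNReal.ofReal (x i (t i)) ∂Measure.pi μ := by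
        refine lintegral_mono_ae ?_
        filter_upwards [ae_pi_forall_mem hD] with t ht using ha.sum_ofReal_mul_le_iSup ht _

end Implementation

section Sufficiency

variable {ι : Type*} [Fintype ι] {X : ι → Type*} [∀ i, MeasurableSpace (X i)]
  {μ : ∀ i, Measure (X i)} [∀ i, IsProbabilityMeasure (μ i)] {q x : ∀ i, X i → ℝ}

theorem measurable_efficientShares_profile (hx : ∀ i, Measurable (x i)) :
    Measurable fun t : ∀ i, X i => efficientShares fun i => x i (t i) :=
  measurable_efficientShares.comp
    (measurable_pi_lambda _ fun i => (hx i).comp (measurable_pi_apply i))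

theorem memLp_of_forall_mem_feasibleShares {Ω : Type*} [MeasurableSpace Ω] {P : Measure Ω}
    [IsFiniteMeasure P] {a : Ω → EuclideanSpace ℝ ι} (ha : Measurable a)
    (hmem : ∀ t, a t ∈ feasibleShares ι) (p : ℝ≥0∞) : MemLp a p P := by
  obtain ⟨R, hR⟩ := isBounded_feasibleShares (ι := ι).exists_norm_le
  exact MemLp.of_bound ha.aestronglyMeasurable R (.of_forall fun t => hR _ (hmem t))

theorem integrable_sum_mul_efficientShares (hx : ∀ i, Measurable (x i))
    (hx₂ : ∀ i, MemLp (x i) 2 (μ i)) :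
    Integrable (fun t => ∑ i, x i (t i) * efficientShares (fun k => x k (t k)) i)
      (Measure.pi μ) := by
  have hshares : MemLp (fun t => efficientShares fun k => x k (t k)) 2 (Measure.pi μ) :=
    memLp_of_forall_mem_feasibleShares (measurable_efficientShares_profile hx)
      (fun t => efficientShares_mem_feasibleShares _) 2
  exact integrable_finsetSum _ fun i _ =>
    ((hx₂ i).comp_measurePreserving (measurePreserving_eval μ i)).integrable_mul
      (hshares.eval_piLp i)

theorem SurplusBound.sum_integral_mul_le (h : SurplusBound μ q x)
    (hq : ∀ i, MemLp (q i) 2 (μ i)) (hq_nonneg : ∀ i, 0 ≤ᵐ[μ i] q i)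
    (hx : ∀ i, Measurable (x i)) (hx₂ : ∀ i, MemLp (x i) 2 (μ i)) :
    ∑ i, ∫ s, q i s * x i s ∂μ i ≤
      ∫ t, ∑ i, x i (t i) * efficientShares (fun k => x k (t k)) i ∂Measure.pi μ := by
  have hint : ∀ i, Integrable (fun s => q i s * x i s) (μ i) := fun i =>
    (hq i).integrable_mul (hx₂ i)
  refine (ENNReal.ofReal_le_ofReal_iff
    (integral_nonneg fun t => sum_mul_efficientShares_nonneg _)).1 ?_
  calc ENNReal.ofReal (∑ i, ∫ s, q i s * x i s ∂μ i)
      ≤ ∑ i, ENNReal.ofReal (∫ s, q i s * x i s ∂μ i) :=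
        Finset.le_sum_of_subadditive _ ENNReal.ofReal_zero.le (fun _ _ => ENNReal.ofReal_add_le) _ _
    _ ≤ ∑ i, ∫⁻ s, ENNReal.ofReal (q i s * x i s) ∂μ i :=
        Finset.sum_le_sum fun i _ => ofReal_integral_le_lintegral_ofReal (hint i)
    _ = ∑ i, ∫⁻ s, ENNReal.ofReal (q i s) * ENNReal.ofReal (x i s) ∂μ i := by
        refine Finset.sum_congr rfl fun i _ => lintegral_congr_ae ?_
        filter_upwards [hq_nonneg i] with s hs using ENNReal.ofReal_mul hs
    _ ≤ ∫⁻ t, ⨆ i, ENNReal.ofReal (x i (t i)) ∂Measure.pi μ := h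
    _ = ENNReal.ofReal
        (∫ t, ∑ i, x i (t i) * efficientShares (fun k => x k (t k)) i ∂Measure.pi μ) := by
        rw [ofReal_integral_eq_lintegral_ofReal (integrable_sum_mul_efficientShares hx hx₂)
          (.of_forall fun t => sum_mul_efficientShares_nonneg _)]
        simp only [ofReal_sum_mul_efficientShares]

theorem exists_mem_aeValuedIn_inner_le (hq : ∀ i, MemLp (q i) 2 (μ i))
    (hq_nonneg : ∀ i, 0 ≤ᵐ[μ i] q i)
    (h : ∀ x : ∀ i, X i → ℝ, (∀ i, Measurable (x i)) → SurplusBound μ q x)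
    (z : PiLp 2 fun i => Lp ℝ 2 (μ i)) :
    ∃ y ∈ aeValuedIn (feasibleShares ι) 2 (Measure.pi μ),
      inner ℝ z (WithLp.toLp 2 fun i => (hq i).toLp) ≤ inner ℝ z (profileInterimCLM μ y) := by
  have hz : ∀ i, Measurable (z i) := fun i => (Lp.stronglyMeasurable _).measurable
  have hshares : MemLp (fun t => efficientShares fun i => z i (t i)) 2 (Measure.pi μ) :=
    memLp_of_forall_mem_feasibleShares (measurable_efficientShares_profile hz)
      (fun t => efficientShares_mem_feasibleShares _) 2
  refine ⟨hshares.toLp, ?_, ?_⟩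
  · filter_upwards [hshares.coeFn_toLp] with t ht
    exact ht ▸ efficientShares_mem_feasibleShares _
  calc inner ℝ z (WithLp.toLp 2 fun i => (hq i).toLp)
      = ∑ i, ∫ s, q i s * z i s ∂μ i := by
        rw [PiLp.inner_apply]
        refine Finset.sum_congr rfl fun i _ => integral_congr_ae ?_
        filter_upwards [(hq i).coeFn_toLp] with s hs
        rw [hs, Real.inner_apply, mul_comm]
    _ ≤ ∫ t, ∑ i, z i (t i) * efficientShares (fun k => z k (t k)) i ∂Measure.pi μ :=
        (h _ hz).sum_integral_mul_le hq hq_nonneg hz fun i => Lp.memLp (z i)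
    _ = inner ℝ z (profileInterimCLM μ hshares.toLp) := by
        rw [inner_profileInterimCLM]
        refine integral_congr_ae ?_
        filter_upwards [hshares.coeFn_toLp] with t ht
        rw [ht]

theorem exists_measurable_interim_ae_eq [DecidableEq ι] (hq : ∀ i, MemLp (q i) 2 (μ i))
    (hq_nonneg : ∀ i, 0 ≤ᵐ[μ i] q i)
    (h : ∀ x : ∀ i, X i → ℝ, (∀ i, Measurable (x i)) → SurplusBound μ q x) :
    ∃ a : (∀ i, X i) → EuclideanSpace ℝ ι, Measurable a ∧ (∀ t, a t ∈ feasibleShares ι) ∧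
      ∀ i, q i =ᵐ[μ i] interim μ (fun t => a t i) i := by
  let Q := aeValuedIn (feasibleShares ι) 2 (Measure.pi μ)
  have hQconvex : Convex ℝ Q := convex_aeValuedIn convex_feasibleShares
  have hTQ : IsClosed (profileInterimCLM μ '' Q) :=
    isClosed_image_of_isClosed_of_convex_of_isBounded _
      (isClosed_aeValuedIn isClosed_feasibleShares) hQconvex
      (isBounded_aeValuedIn isBounded_feasibleShares)
  obtain ⟨y, hyQ, hy⟩ : WithLp.toLp 2 (fun i => (hq i).toLp) ∈ profileInterimCLM μ '' Q := by
    refine mem_of_forall_exists_real_inner_le hTQ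
      (hQconvex.linear_image (profileInterimCLM μ).toLinearMap) fun z => ?_
    obtain ⟨y, hyQ, hle⟩ := exists_mem_aeValuedIn_inner_le hq hq_nonneg h z
    exact ⟨_, ⟨y, hyQ, rfl⟩, hle⟩
  obtain ⟨a, ha, hamem, hay⟩ := exists_measurable_forall_mem_ae_eq
    isClosed_feasibleShares.measurableSet ⟨0, zero_mem_feasibleShares⟩ hyQ
  refine ⟨a, ha, hamem, fun i => ?_⟩
  have hqy : (hq i).toLp = profileInterimCLM μ y i := congrArg (fun w => w i) hy.symm
  calc q i =ᵐ[μ i] profileInterimCLM μ y i := hqy ▸ (hq i).coeFn_toLp.symm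
    _ =ᵐ[μ i] interim μ (fun t => y t i) i := coeFn_profileInterimCLM μ y i
    _ =ᵐ[μ i] interim μ (fun t => a t i) i := interim_congr_ae (hay.symm.fun_comp fun c => c i) i

end Sufficiency

section NullTypes

variable {ι : Type*} {X : ι → Type*} {N D : ∀ i, Set (X i)} {q : ∀ i, X i → ℝ}
  {a : ι → (∀ i, X i) → ℝ}

open Classical in
/-- The allocation `a`, modified where some type lies in the exceptional sets `N i`: a bidder who
is alone in having an exceptional type `s` obtains the item with probability `q i s`, the others
nothing, and two or more exceptional types leave it unallocated.  When the `N i` are null sets this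
prescribes the interim allocation at the exceptional types without affecting it elsewhere. -/
noncomputable def overrideOn (N : ∀ i, Set (X i)) (q : ∀ i, X i → ℝ)
    (a : ι → (∀ i, X i) → ℝ) (i : ι) (t : ∀ i, X i) : ℝ :=
  if ∀ k, k ≠ i → t k ∉ N k then (if t i ∈ N i then q i (t i) else a i t) else 0

theorem overrideOn_of_forall_notMem {t : ∀ i, X i} (ht : ∀ k, t k ∉ N k) (i : ι) :
    overrideOn N q a i t = a i t := by
  rw [overrideOn, if_pos fun k _ => ht k, if_neg (ht i)]

theorem overrideOn_of_mem {t : ∀ i, X i} {j : ι} (hj : t j ∈ N j) {i : ι} (hij : i ≠ j) :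
    overrideOn N q a i t = 0 :=
  if_neg fun h => h j hij.symm hj

theorem overrideOn_self_of_mem {t : ∀ i, X i} {j : ι} (hj : t j ∈ N j) :
    overrideOn N q a j t = q j (t j) ∨ overrideOn N q a j t = 0 := by
  unfold overrideOn
  split_ifs
  exacts [.inl rfl, .inr rfl]

variable [∀ i, MeasurableSpace (X i)]

theorem measurable_overrideOn [Countable ι] (hN : ∀ i, MeasurableSet (N i))
    (hq : ∀ i, Measurable (q i)) (ha : ∀ i, Measurable (a i)) (i : ι) :
    Measurable (overrideOn N q a i) := by
  have hother : MeasurableSet {t : ∀ i, X i | ∀ k, k ≠ i → t k ∉ N k} := by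
    simp only [Set.ofPred_forall]
    exact .iInter fun k => .iInter fun _ => (measurable_pi_apply k (hN k)).compl
  exact Measurable.ite hother (Measurable.ite (measurable_pi_apply i (hN i))
    ((hq i).comp (measurable_pi_apply i)) (ha i)) measurable_const

theorem IsAllocation.overrideOn [Fintype ι] (ha : IsAllocation D a)
    (hN : ∀ i, MeasurableSet (N i)) (hq : ∀ i, Measurable (q i))
    (hq_mem : ∀ i, ∀ s ∈ D i, q i s ∈ Set.Icc 0 1) : IsAllocation D (overrideOn N q a) := by
  refine ⟨measurable_overrideOn hN hq ha.measurable, fun t ht i => ?_, fun t ht => ?_⟩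
  · unfold Auction.overrideOn
    split_ifs
    exacts [(hq_mem i _ (ht i)).1, ha.nonneg t ht i, le_rfl]
  · by_cases hex : ∃ j, t j ∈ N j
    · obtain ⟨j, hj⟩ := hex
      rw [Finset.sum_eq_single j (fun i _ hij => overrideOn_of_mem hj hij) (by simp)]
      rcases overrideOn_self_of_mem (q := q) (a := a) hj with h | h <;> rw [h]
      exacts [(hq_mem j _ (ht j)).2, zero_le_one]
    · simp only [overrideOn_of_forall_notMem (not_exists.1 hex), ha.sum_le_one t ht]

variable [Fintype ι] [DecidableEq ι] {μ : ∀ i, Measure (X i)} [∀ i, IsProbabilityMeasure (μ i)]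

theorem interim_overrideOn (hN : ∀ i, μ i (N i) = 0) (i : ι) (s : X i) [Decidable (s ∈ N i)] :
    interim μ (overrideOn N q a i) i s = if s ∈ N i then q i s else interim μ (a i) i s := by
  have hae : ∀ᵐ t ∂Measure.pi μ, ∀ k, t k ∈ (N k)ᶜ :=
    ae_pi_forall_mem fun k => compl_mem_ae_iff.2 (hN k)
  have hother : ∀ t : ∀ k, X k, (∀ k, t k ∈ (N k)ᶜ) →
      ∀ k, k ≠ i → Function.update t i s k ∉ N k := fun t ht k hk => by
    rw [Function.update_of_ne hk]
    exact ht k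
  split_ifs with hs
  · calc interim μ (overrideOn N q a i) i s = ∫ _, q i s ∂Measure.pi μ := by
          refine integral_congr_ae ?_
          filter_upwards [hae] with t ht
          rw [overrideOn, if_pos (hother t ht), Function.update_self, if_pos hs]
      _ = q i s := by simp
  · refine integral_congr_ae ?_
    filter_upwards [hae] with t ht
    rw [overrideOn, if_pos (hother t ht), Function.update_self, if_neg hs]

theorem interimImplementable_of_ae_eq (ha : IsAllocation D a) (hq : ∀ i, Measurable (q i))
    (hq_mem : ∀ i, ∀ s ∈ D i, q i s ∈ Set.Icc 0 1) (h : ∀ i, q i =ᵐ[μ i] interim μ (a i) i) :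
    InterimImplementable μ D q := by
  classical
  choose N hsub hN hN_null using fun i => exists_measurable_superset_of_null (ae_iff.1 (h i))
  refine ⟨overrideOn N q a, ha.overrideOn hN hq hq_mem, fun i s _ => ?_⟩
  rw [interim_overrideOn hN_null]
  split_ifs with hs
  · rfl
  · exact not_not.1 fun hne => hs (hsub i hne)

theorem InterimImplementable.of_forall_surplusBound (hD : ∀ i, ∀ᵐ s ∂μ i, s ∈ D i)
    (hq : ∀ i, Measurable (q i)) (hq_mem : ∀ i, ∀ s ∈ D i, q i s ∈ Set.Icc 0 1)
    (h : ∀ x : ∀ i, X i → ℝ, (∀ i, Measurable (x i)) → SurplusBound μ q x) :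
    InterimImplementable μ D q := by
  have hq₂ : ∀ i, MemLp (q i) 2 (μ i) := fun i => by
    refine MemLp.of_bound (hq i).aestronglyMeasurable 1 ?_
    filter_upwards [hD i] with s hs
    rw [Real.norm_of_nonneg (hq_mem i s hs).1]
    exact (hq_mem i s hs).2
  have hq_nonneg : ∀ i, 0 ≤ᵐ[μ i] q i := fun i => by
    filter_upwards [hD i] with s hs using (hq_mem i s hs).1
  obtain ⟨a, ha, hamem, hqa⟩ := exists_measurable_interim_ae_eq hq₂ hq_nonneg h
  have halloc : IsAllocation D fun i t => a t i :=
    ⟨fun i => (EuclideanSpace.proj i).continuous.measurable.comp ha,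
      fun t _ => (hamem t).1, fun t _ => (hamem t).2⟩
  exact interimImplementable_of_ae_eq halloc hq hq_mem hqa

end NullTypes

section Border

variable {ι : Type*} [Fintype ι] {X : ι → Type*} [∀ i, MeasurableSpace (X i)]
  {μ : ∀ i, Measure (X i)} [∀ i, IsProbabilityMeasure (μ i)] {D S : ∀ i, Set (X i)}
  {q : ∀ i, X i → ℝ}

theorem measureReal_pi_exists_mem (hS : ∀ i, MeasurableSet (S i)) :
    (Measure.pi μ).real {t | ∃ i, t i ∈ S i} = 1 - ∏ i, (1 - (μ i).real (S i)) := by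
  have hcompl : {t : ∀ i, X i | ∃ i, t i ∈ S i}ᶜ = Set.univ.pi fun i => (S i)ᶜ := by
    ext t
    simp
  rw [eq_sub_iff_add_eq, ← eq_sub_iff_add_eq', ← probReal_compl_eq_one_sub
    (measurableSet_exists_mem hS), hcompl, measureReal_def, Measure.pi_pi, ENNReal.toReal_prod]
  exact Finset.prod_congr rfl fun i _ => (probReal_compl_eq_one_sub (hS i)).symm

theorem measure_pi_exists_mem_inter (hD : ∀ i, ∀ᵐ s ∂μ i, s ∈ D i) :
    Measure.pi μ {t | ∃ i, t i ∈ D i ∩ S i} = Measure.pi μ {t | ∃ i, t i ∈ S i} := by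
  refine measure_congr ?_
  filter_upwards [ae_pi_forall_mem hD] with t ht
  exact propext (exists_congr fun i => and_iff_right (ht i))

theorem borderBound_iff_sum_integral_le (hS : ∀ i, MeasurableSet (S i))
    (hq : ∀ i, Integrable (q i) (μ i)) (hq_nonneg : ∀ i, 0 ≤ᵐ[μ i] q i) :
    BorderBound μ q S ↔
      ∑ i, ∫ s in S i, q i s ∂μ i ≤ 1 - ∏ i, (1 - (μ i).real (S i)) := by
  have hleft : ∀ i, ∫⁻ s in S i, ENNReal.ofReal (q i s) ∂μ i =
      ENNReal.ofReal (∫ s in S i, q i s ∂μ i) := fun i =>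
    (ofReal_integral_eq_lintegral_ofReal (hq i).restrict (ae_restrict_of_ae (hq_nonneg i))).symm
  simp only [BorderBound, hleft]
  rw [← ENNReal.ofReal_sum_of_nonneg fun i _ =>
    integral_nonneg_of_ae (ae_restrict_of_ae (hq_nonneg i)), ← measureReal_pi_exists_mem hS,
    ENNReal.ofReal_le_iff_le_toReal (measure_ne_top _ _), measureReal_def]

theorem borderBound_inter_iff (hD : ∀ i, ∀ᵐ s ∂μ i, s ∈ D i) :
    BorderBound μ q (fun i => D i ∩ S i) ↔ BorderBound μ q S := by
  have hrestrict : ∀ i, (μ i).restrict (D i ∩ S i) = (μ i).restrict (S i) := fun i =>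
    Measure.restrict_congr_set <| by
      filter_upwards [hD i] with s hs using propext (and_iff_right hs)
  simp only [BorderBound, hrestrict, measure_pi_exists_mem_inter hD]

variable [DecidableEq ι]

theorem interimImplementable_iff_forall_surplusBound (hD : ∀ i, ∀ᵐ s ∂μ i, s ∈ D i)
    (hq : ∀ i, Measurable (q i)) (hq_mem : ∀ i, ∀ s ∈ D i, q i s ∈ Set.Icc 0 1) :
    InterimImplementable μ D q ↔
      ∀ x : ∀ i, X i → ℝ, (∀ i, Measurable (x i) ∧ ∀ s ∈ D i, 0 ≤ x i s) →
        SurplusBound μ q x := by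
  refine ⟨fun h x hx => h.surplusBound hD fun i => (hx i).1, fun h => ?_⟩
  exact .of_forall_surplusBound hD hq hq_mem fun x hx => surplusBound_max_zero_iff.1
    (h _ fun i => ⟨(hx i).max measurable_const, fun s _ => le_max_right _ _⟩)

theorem interimImplementable_iff_forall_borderBound (hD : ∀ i, ∀ᵐ s ∂μ i, s ∈ D i)
    (hq : ∀ i, Measurable (q i)) (hq_mem : ∀ i, ∀ s ∈ D i, q i s ∈ Set.Icc 0 1) :
    InterimImplementable μ D q ↔
      ∀ S : ∀ i, Set (X i), (∀ i, MeasurableSet (S i) ∧ S i ⊆ D i) → BorderBound μ q S := by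
  refine ⟨fun h S hS => ?_, fun h => ?_⟩
  · exact (surplusBound_indicator_iff fun i => (hS i).1).1
      (h.surplusBound hD fun i => measurable_const.indicator (hS i).1)
  · choose N hDN hN hN_null using fun i => exists_measurable_superset_of_null (hD i)
    refine .of_forall_surplusBound hD hq hq_mem fun x =>
      surplusBound_of_forall_borderBound hq fun S hS => ?_
    exact (borderBound_inter_iff fun i => compl_mem_ae_iff.2 (hN_null i)).1 <| h _ fun i =>
      ⟨(hN i).compl.inter (hS i), Set.inter_subset_left.trans (Set.compl_subset_comm.1 (hDN i))⟩

end Border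

section TypeLaw

variable {b : ℝ} {f : ℝ → ℝ}

theorem ae_typeLaw_mem_Icc (b : ℝ) (f : ℝ → ℝ) : ∀ᵐ s ∂typeLaw b f, s ∈ Set.Icc 0 b :=
  (withDensity_absolutelyContinuous _ _).ae_le (ae_restrict_mem measurableSet_Icc)

theorem IsTypeDensity.isProbabilityMeasure (hf : IsTypeDensity b f) :
    IsProbabilityMeasure (typeLaw b f) := by
  have hint : IntegrableOn f (Set.Icc 0 b) :=
    not_imp_comm.1 integral_undef (hf.integral_eq_one.trans_ne one_ne_zero)
  constructor
  rw [typeLaw, withDensity_apply _ MeasurableSet.univ, Measure.restrict_univ,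
    ← ofReal_integral_eq_lintegral_ofReal hint, hf.integral_eq_one, ENNReal.ofReal_one]
  exact (ae_restrict_iff' measurableSet_Icc).2 (.of_forall hf.nonneg)

theorem IsTypeDensity.lintegral_typeLaw (hf : IsTypeDensity b f) {g : ℝ → ℝ≥0∞}
    (hg : Measurable g) :
    ∫⁻ s, g s ∂typeLaw b f = ∫⁻ t in Set.Icc 0 b, ENNReal.ofReal (f t) * g t :=
  lintegral_withDensity_eq_lintegral_mul _ hf.measurable.ennreal_ofReal hg

theorem IsTypeDensity.setIntegral_typeLaw (hf : IsTypeDensity b f) (g : ℝ → ℝ) {S : Set ℝ}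
    (hS : MeasurableSet S) (hSb : S ⊆ Set.Icc 0 b) :
    ∫ s in S, g s ∂typeLaw b f = ∫ t in S, g t * f t := by
  rw [typeLaw, setIntegral_withDensity_eq_setIntegral_toReal_smul hf.measurable.ennreal_ofReal
    (.of_forall fun _ => ENNReal.ofReal_lt_top) _ hS, Measure.restrict_restrict hS,
    Set.inter_eq_left.2 hSb]
  refine setIntegral_congr_fun hS fun t ht => ?_
  change (ENNReal.ofReal (f t)).toReal * g t = g t * f t
  rw [ENNReal.toReal_ofReal (hf.nonneg t (hSb ht)), mul_comm]

theorem IsTypeDensity.measureReal_typeLaw (hf : IsTypeDensity b f) {S : Set ℝ}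
    (hS : MeasurableSet S) (hSb : S ⊆ Set.Icc 0 b) :
    (typeLaw b f).real S = ∫ t in S, f t := by
  have := hf.setIntegral_typeLaw 1 hS hSb
  simpa using this

end TypeLaw

section Auctions

variable {m n : ℕ} {b : ℝ} {f : Fin n → ℝ → ℝ}

theorem borderInequality_iff {q : Fin n → ℝ → ℝ} {S : Fin n → Set ℝ}
    (hf : ∀ i, IsTypeDensity b (f i)) (hq : ∀ i, Measurable (q i))
    (hq_mem : ∀ i, ∀ s ∈ Set.Icc 0 b, q i s ∈ Set.Icc (0 : ℝ) 1)
    (hS : ∀ i, MeasurableSet (S i) ∧ S i ⊆ Set.Icc 0 b) :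
    BorderInequality f q S ↔ BorderBound (fun i => typeLaw b (f i)) q S := by
  have := fun i => (hf i).isProbabilityMeasure
  have hq_ae : ∀ i, ∀ᵐ s ∂typeLaw b (f i), q i s ∈ Set.Icc 0 1 := fun i => by
    filter_upwards [ae_typeLaw_mem_Icc b (f i)] with s hs using hq_mem i s hs
  rw [borderBound_iff_sum_integral_le (fun i => (hS i).1)
    (fun i => .of_mem_Icc 0 1 (hq i).aemeasurable (hq_ae i))
    (fun i => (hq_ae i).mono fun s hs => hs.1)]
  simp only [BorderInequality, fun i => (hf i).setIntegral_typeLaw (q i) (hS i).1 (hS i).2,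
    fun i => (hf i).measureReal_typeLaw (hS i).1 (hS i).2]

theorem surplusInequality_iff {q x : Fin n → ℝ → ℝ} (hf : ∀ i, IsTypeDensity b (f i))
    (hq : ∀ i, Measurable (q i)) (hq_nonneg : ∀ i, ∀ s ∈ Set.Icc 0 b, 0 ≤ q i s)
    (hx : ∀ i, Measurable (x i)) :
    SurplusInequality b f q x ↔ SurplusBound (fun i => typeLaw b (f i)) q x := by
  have := fun i => (hf i).isProbabilityMeasure
  have hleft : ∀ i, ∫⁻ t in Set.Icc 0 b, ENNReal.ofReal (q i t * f i t * x i t) =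
      ∫⁻ s, ENNReal.ofReal (q i s) * ENNReal.ofReal (x i s) ∂typeLaw b (f i) := fun i => by
    rw [(hf i).lintegral_typeLaw (g := fun s => ENNReal.ofReal (q i s) * ENNReal.ofReal (x i s))
      ((hq i).ennreal_ofReal.mul (hx i).ennreal_ofReal)]
    refine setLIntegral_congr_fun measurableSet_Icc fun t ht => ?_
    rw [ENNReal.ofReal_mul (mul_nonneg (hq_nonneg i t ht) ((hf i).nonneg t ht)),
      ENNReal.ofReal_mul (hq_nonneg i t ht), mul_left_comm, mul_assoc]
  have hlevel : ∀ v i, MeasurableSet (Set.Icc 0 b ∩ {t | v ≤ x i t}) := fun v i =>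
    measurableSet_Icc.inter (measurableSet_le measurable_const (hx i))
  have hright : ∀ v, ENNReal.ofReal
      (1 - ∏ i, (1 - ∫ t in Set.Icc 0 b ∩ {t | v ≤ x i t}, f i t)) =
      Measure.pi (fun i => typeLaw b (f i)) {t | ∃ i, v ≤ x i (t i)} := fun v => by
    simp only [← fun i => (hf i).measureReal_typeLaw (hlevel v i) Set.inter_subset_left]
    rw [← measureReal_pi_exists_mem (hlevel v), ofReal_measureReal,
      measure_pi_exists_mem_inter fun i => ae_typeLaw_mem_Icc b (f i)]
    rfl
  rw [SurplusBound, lintegral_iSup_ofReal_eq_lintegral_meas_exists_le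
    (z := fun i (t : Fin n → ℝ) => x i (t i)) fun i => (hx i).comp (measurable_pi_apply i)]
  simp only [← hleft, ← hright]
  rfl

theorem isVirtualValue_iff {x : ℝ → ℝ} :
    IsVirtualValue b x ↔ Measurable x ∧ ∀ s ∈ Set.Icc 0 b, 0 ≤ x s :=
  ⟨fun h => ⟨h.measurable, h.nonneg⟩, fun h => ⟨h.1, h.2⟩⟩

theorem implementable_iff {q : Fin m → Fin n → ℝ → ℝ} :
    Implementable b f q ↔
      ∀ j, InterimImplementable (fun i => typeLaw b (f i)) (fun _ => Set.Icc 0 b) (q j) := by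
  constructor
  · rintro ⟨M, hM, hq⟩ j
    exact ⟨M.alloc j, ⟨M.measurable_alloc j, fun t ht => (hM t ht j).1,
      fun t ht => (hM t ht j).2⟩, hq j⟩
  · intro h
    choose a ha hq using h
    exact ⟨⟨a, 0, fun j => (ha j).measurable, fun _ => measurable_zero⟩,
      fun t ht j => ⟨(ha j).nonneg t ht, (ha j).sum_le_one t ht⟩, hq⟩

end Auctions

end Auction

open Auction in
theorem mainTheorem2_general {ι κ : Type*} [Fintype ι] [DecidableEq ι] {X : ι → Type*}
    [∀ i, MeasurableSpace (X i)] (μ : ∀ i, Measure (X i)) [∀ i, IsProbabilityMeasure (μ i)]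
    (D : ∀ i, Set (X i)) (hD : ∀ i, ∀ᵐ s ∂μ i, s ∈ D i)
    (q : κ → ∀ i, X i → ℝ) (hq : ∀ j i, Measurable (q j i))
    (hq_mem : ∀ j i, ∀ s ∈ D i, q j i s ∈ Set.Icc 0 1) :
    ((∀ j, InterimImplementable μ D (q j)) ↔
      ∀ x : κ → ∀ i, X i → ℝ, (∀ j i, Measurable (x j i) ∧ ∀ s ∈ D i, 0 ≤ x j i s) →
        ∀ j, SurplusBound μ (q j) (x j)) ∧
    (∀ S : ∀ i, Set (X i), (∀ i, MeasurableSet (S i)) → ∀ j,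
      (SurplusBound μ (q j) (fun i => (S i).indicator fun _ => 1) ↔ BorderBound μ (q j) S)) ∧
    ((∀ j, InterimImplementable μ D (q j)) ↔
      ∀ S : ∀ i, Set (X i), (∀ i, MeasurableSet (S i) ∧ S i ⊆ D i) →
        ∀ j, BorderBound μ (q j) S) := by
  refine ⟨?_, fun S hS j => surplusBound_indicator_iff hS, ?_⟩
  · simp only [fun j => interimImplementable_iff_forall_surplusBound hD (hq j) (hq_mem j)]
    exact ⟨fun h x hx j => h j (x j) (hx j), fun h j x hx => h (fun _ => x) (fun _ => hx) j⟩
  · simp only [fun j => interimImplementable_iff_forall_borderBound hD (hq j) (hq_mem j)]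
    exact ⟨fun h S hS j => h j S hS, fun h j S hS => h S hS j⟩

theorem mainTheorem2 {m n : ℕ} (b : ℝ) (hb : 0 < b)
    (f : Fin n → ℝ → ℝ) (hf : ∀ i, Auction.IsTypeDensity b (f i))
    (q : Fin m → Fin n → ℝ → ℝ) (hq : Auction.IsInterimRule b q) :
    -- the generalized Border theorem
    (Auction.Implementable b f q ↔
      ∀ x : Fin m → Fin n → ℝ → ℝ, (∀ j i, Auction.IsVirtualValue b (x j i)) →
        ∀ j, Auction.SurplusInequality b f (q j) (x j)) ∧
    -- for indicator functions the surplus inequality is Border's inequality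
    (∀ S : Fin n → Set ℝ, (∀ i, MeasurableSet (S i) ∧ S i ⊆ Set.Icc 0 b) →
      ∀ j, (Auction.SurplusInequality b f (q j) (fun i => (S i).indicator (fun _ => (1 : ℝ))) ↔
        Auction.BorderInequality f (q j) S)) ∧
    -- Border's theorem
    (Auction.Implementable b f q ↔
      ∀ S : Fin n → Set ℝ, (∀ i, MeasurableSet (S i) ∧ S i ⊆ Set.Icc 0 b) →
        ∀ j, Auction.BorderInequality f (q j) S) := by
  have := fun i => (hf i).isProbabilityMeasure
  obtain ⟨hsurplus, hindicator, hborder⟩ :=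
    mainTheorem2_general (fun i => Auction.typeLaw b (f i)) (fun _ => Set.Icc 0 b)
      (fun i => Auction.ae_typeLaw_mem_Icc b (f i)) q hq.measurable hq.mem_Icc
  have hsurplus_iff := fun j x => Auction.surplusInequality_iff (x := x) hf (hq.measurable j)
    (fun i s hs => (hq.mem_Icc j i s hs).1)
  have hborder_iff := fun j S => Auction.borderInequality_iff (S := S) hf (hq.measurable j)
    (hq.mem_Icc j)
  simp only [Auction.implementable_iff, Auction.isVirtualValue_iff]
  refine ⟨hsurplus.trans ?_, fun S hS j => ?_, hborder.trans ?_⟩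
  · exact forall₃_congr fun x hx j => (hsurplus_iff j _ fun i => (hx j i).1).symm
  · rw [hsurplus_iff j _ fun i => measurable_const.indicator (hS i).1, hborder_iff j S hS]
    exact hindicator S (fun i => (hS i).1) j
  · exact forall₃_congr fun S hS j => (hborder_iff j S hS).symm
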